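/- Let $n\ge 0$ and let $\mathcal{G}$ be any set of $n$-qubit Pauli strings, i.e. of operators $\sigma_1\otimes\cdots\otimes\sigma_n$ on $(\mathbb{C}^2)^{\otimes n}$ with every $\sigma_i\in\{I,X,Y,Z\}$. The commutator graph of $\mathcal{G}$ has the $4^n$ Pauli strings on $n$ qubits as its vertices, and two strings $p$ and $q$ are joined by an edge if there is an $X\in\mathcal{G}$ such that $[p,X]$ is a nonzero scalar multiple of $q$. For a Pauli string $P$ let $C(P)$ be the set of vertices of the connected component of this graph that contains $P$. Then for all $n$-qubit Pauli strings $V$ and $W$ $$\frac{|\{T\in C(W) : [V,T]=0\}|}{|C(W)|} = \frac{|\{T\in C(V) : [W,T]=0\}|}{|C(V)|}$$ and $$\frac{|\{T\in C(W) : \{V,T\}=0\}|}{|C(W)|} = \frac{|\{T\in C(V) : \{W,T\}=0\}|}{|C(V)|},$$ where $[A,B]=AB-BA$, $\{A,B\}=AB+BA$, and $|S|$ is the number of elements of the set $S$. -/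

import Mathlib

/-- The four single-qubit Pauli operators. -/
inductive Pauli
  | I | X | Y | Z
  deriving DecidableEq

namespace Pauli

instance : Fintype Pauli := ⟨{I, X, Y, Z}, fun p => by cases p <;> simp⟩

/-- The `2 × 2` complex matrix of a single-qubit Pauli operator. -/
def toMatrix : Pauli → Matrix (Fin 2) (Fin 2) ℂ
  | I => !![1, 0; 0, 1]
  | X => !![0, 1; 1, 0]
  | Y => !![0, -Complex.I; Complex.I, 0]
  | Z => !![1, 0; 0, -1]

theorem toMatrix_mul_self (p : Pauli) : p.toMatrix * p.toMatrix = 1 := by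
  cases p <;> ext i j <;> fin_cases i <;> fin_cases j <;>
    simp [toMatrix, Matrix.mul_apply, Fin.sum_univ_two]

theorem toMatrix_mul_comm_sign (p q : Pauli) :
    ∃ s : ℂ, (s = 1 ∨ s = -1) ∧ p.toMatrix * q.toMatrix = s • (q.toMatrix * p.toMatrix) := by
  by_cases h : p = I ∨ q = I ∨ p = q
  · refine ⟨1, Or.inl rfl, ?_⟩
    rcases h with rfl | rfl | rfl
    · cases q <;> ext i j <;> fin_cases i <;> fin_cases j <;>
        simp [toMatrix, Matrix.mul_apply, Fin.sum_univ_two]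
    · cases p <;> ext i j <;> fin_cases i <;> fin_cases j <;>
        simp [toMatrix, Matrix.mul_apply, Fin.sum_univ_two]
    · simp
  · refine ⟨-1, Or.inr rfl, ?_⟩
    cases p <;> cases q <;> simp at h <;> ext i j <;> fin_cases i <;> fin_cases j <;>
      simp [toMatrix, Matrix.mul_apply, Fin.sum_univ_two]

end Pauli

/-- An `n`-qubit Pauli string: a choice of a single-qubit Pauli operator on each qubit
(there are `4 ^ n` of them). -/
abbrev PauliString (n : ℕ) : Type := Fin n → Pauli

namespace PauliString

variable {n : ℕ}

/-- The operator of a Pauli string on the `n`-qubit space `(ℂ²)^{⊗ n}`: the tensor (Kronecker)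
product of its factors, in the computational basis indexed by bit strings `Fin n → Fin 2`. -/
def toMatrix (P : PauliString n) : Matrix (Fin n → Fin 2) (Fin n → Fin 2) ℂ :=
  Matrix.of fun a b => ∏ i, (P i).toMatrix (a i) (b i)

theorem toMatrix_mul_apply (P Q : PauliString n) (a b : Fin n → Fin 2) :
    (P.toMatrix * Q.toMatrix) a b = ∏ i, ((P i).toMatrix * (Q i).toMatrix) (a i) (b i) := by
  simp only [Matrix.mul_apply, toMatrix, Matrix.of_apply, ← Finset.prod_mul_distrib]
  rw [Finset.prod_univ_sum, Fintype.piFinset_univ]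

theorem toMatrix_mul_self (P : PauliString n) : P.toMatrix * P.toMatrix = 1 := by
  ext a b
  rw [toMatrix_mul_apply]
  simp only [Pauli.toMatrix_mul_self, Matrix.one_apply]
  rw [Finset.prod_ite_zero]
  simp [funext_iff]

theorem mul_eq_or_eq_neg (P Q : PauliString n) :
    P.toMatrix * Q.toMatrix = Q.toMatrix * P.toMatrix ∨
      P.toMatrix * Q.toMatrix = -(Q.toMatrix * P.toMatrix) := by
  choose s hs h using fun i => Pauli.toMatrix_mul_comm_sign (P i) (Q i)
  have hprod : P.toMatrix * Q.toMatrix = (∏ i, s i) • (Q.toMatrix * P.toMatrix) := by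
    ext a b
    rw [Matrix.smul_apply, toMatrix_mul_apply, toMatrix_mul_apply, smul_eq_mul,
      ← Finset.prod_mul_distrib]
    exact Finset.prod_congr rfl fun i _ => by rw [h i]; rfl
  have hsign : (∏ i, s i) = 1 ∨ (∏ i, s i) = -1 := by
    refine Finset.prod_induction s (fun x => x = 1 ∨ x = -1) ?_ (Or.inl rfl) fun i _ => hs i
    rintro x y (rfl | rfl) (rfl | rfl) <;> simp
  rcases hsign with h1 | h1
  · exact Or.inl (by rw [hprod, h1, one_smul])
  · exact Or.inr (by rw [hprod, h1, neg_one_smul])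

/-- The Pauli strings `P` and `Q` commute: `[P, Q] = 0`. -/
def Commutes (P Q : PauliString n) : Prop :=
  P.toMatrix * Q.toMatrix - Q.toMatrix * P.toMatrix = 0

/-- The Pauli strings `P` and `Q` anticommute: `{P, Q} = 0`. -/
def Anticommutes (P Q : PauliString n) : Prop :=
  P.toMatrix * Q.toMatrix + Q.toMatrix * P.toMatrix = 0

end PauliString

/-- The commutator graph of a set `G` of `n`-qubit Pauli strings. The vertices are all `n`-qubit
Pauli strings; `p` and `q` are adjacent if there is an `X ∈ G` such that `[p, X]` is a nonzero
scalar multiple of `q`. -/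
def commutatorGraph {n : ℕ} (G : Set (PauliString n)) : SimpleGraph (PauliString n) where
  Adj p q := ∃ X ∈ G, ∃ c : ℂ, c ≠ 0 ∧
    p.toMatrix * X.toMatrix - X.toMatrix * p.toMatrix = c • q.toMatrix
  symm := ⟨by
    rintro p q ⟨X, hX, c, hc, h⟩
    have hXX := X.toMatrix_mul_self
    have hqq := q.toMatrix_mul_self
    rcases PauliString.mul_eq_or_eq_neg p X with h1 | h1
    · exfalso
      rw [h1, sub_self] at h
      have hq : q.toMatrix = 0 := (smul_eq_zero.mp h.symm).resolve_left hc
      rw [hq, mul_zero] at hqq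
      exact zero_ne_one hqq
    · refine ⟨X, hX, 4 * c⁻¹, mul_ne_zero (by norm_num) (inv_ne_zero hc), ?_⟩
      have hq : q.toMatrix = c⁻¹ • (p.toMatrix * X.toMatrix - X.toMatrix * p.toMatrix) := by
        rw [h, smul_smul, inv_mul_cancel₀ hc, one_smul]
      have h2 : X.toMatrix * p.toMatrix = -(p.toMatrix * X.toMatrix) := by rw [h1, neg_neg]
      have h3 : X.toMatrix * (p.toMatrix * X.toMatrix) = -p.toMatrix := by
        rw [← mul_assoc, h2, neg_mul, mul_assoc, hXX, mul_one]
      rw [hq, h2, smul_mul_assoc, mul_smul_comm, ← smul_sub, mul_comm, mul_smul]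
      congr 1
      rw [sub_neg_eq_add, add_mul, mul_add, h3, mul_assoc, hXX, mul_one]
      module⟩
  loopless := ⟨by
    rintro p ⟨X, -, c, hc, h⟩
    have hpp := p.toMatrix_mul_self
    have key : p.toMatrix * (p.toMatrix * X.toMatrix - X.toMatrix * p.toMatrix) =
        -((p.toMatrix * X.toMatrix - X.toMatrix * p.toMatrix) * p.toMatrix) := by
      rw [mul_sub, sub_mul, ← mul_assoc, hpp, mul_assoc X.toMatrix, hpp]
      noncomm_ring
    rw [h, mul_smul_comm, smul_mul_assoc, hpp, eq_neg_iff_add_eq_zero, ← add_smul] at key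
    rcases smul_eq_zero.mp key with h0 | h0
    · exact hc (by linear_combination h0 / 2)
    · exact one_ne_zero h0⟩

/-- `C(P)`: the set of vertices of the connected component of the commutator graph of `G` that
contains the Pauli string `P`. -/
def component {n : ℕ} (G : Set (PauliString n)) (P : PauliString n) : Set (PauliString n) :=
  ((commutatorGraph G).connectedComponentMk P).supp

/-! Each `X ∈ G` acts on Pauli strings by a transvection: strings anticommuting with `X` are
multiplied by `X`, up to phase, and the others are fixed. Edges are the non-trivial moves of these
involutions, so components are orbits of the group they generate (`component_eq_orbit`). This group
preserves commutation signs (`sign_smul`). An orbit proportion is a proportion of group elements,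
and `h ↦ h⁻¹` exchanges the roles of `V` and `W` (`ncard_orbit_rel_div_comm`). -/

namespace MulAction

variable {H α : Type*} [Group H] [Fintype H] [MulAction H α] [Finite α]

/-- The proportion of an orbit lying in a set is the proportion of group elements which
move the base point into that set. -/
theorem ncard_orbit_inter_div (w : α) (S : Set α) :
    ((orbit H w ∩ S).ncard : ℚ) / ((orbit H w).ncard : ℚ) =
      ({h : H | h • w ∈ S}.ncard : ℚ) / (Fintype.card H : ℚ) := by
  classical
  have := Fintype.ofFinite α
  have horbit : ((orbit H w).ncard : ℚ) ≠ 0 := by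
    exact_mod_cast (Set.ncard_ne_zero_of_mem (mem_orbit_self w))
  have hcard : (Fintype.card H : ℚ) ≠ 0 := by exact_mod_cast Fintype.card_ne_zero
  rw [div_eq_div_iff horbit hcard]
  norm_cast
  -- Double counting of pairs `(h, T)` with `h • T ∈ S`: each `h` permutes the orbit, so every row
  -- has the same sum.
  have row (h : H) :
      ∑ T ∈ (orbit H w).toFinset, (if h • T ∈ S then 1 else 0) = (orbit H w ∩ S).ncard := by
    rw [← Finset.card_filter, ← Set.ncard_coe_finset]
    refine Set.ncard_congr (fun T _ => h • T) ?_ (fun _ _ _ _ e => smul_left_cancel h e) ?_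
    · intro T hT
      simp only [Finset.coe_filter, Set.mem_toFinset, Set.mem_ofPred_eq] at hT
      exact ⟨mem_orbit_of_mem_orbit h hT.1, hT.2⟩
    · rintro T ⟨hT, hS⟩
      refine ⟨h⁻¹ • T, ?_, smul_inv_smul h T⟩
      simp only [Finset.coe_filter, Set.mem_toFinset, Set.mem_ofPred_eq, smul_inv_smul]
      exact ⟨mem_orbit_of_mem_orbit h⁻¹ hT, hS⟩
  -- Writing `T = g • w`, the substitution `h ↦ h * g` removes the dependence on `T`.
  have column (T : α) (hT : T ∈ (orbit H w).toFinset) :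
      ∑ h : H, (if h • T ∈ S then 1 else 0) = {h : H | h • w ∈ S}.ncard := by
    obtain ⟨g, rfl⟩ := Set.mem_toFinset.mp hT
    simp only [smul_smul]
    refine (Equiv.sum_comp (Equiv.mulRight g) fun h : H => if h • w ∈ S then 1 else 0).trans ?_
    rw [← Finset.card_filter, ← Set.ncard_coe_finset]
    simp
  calc (orbit H w ∩ S).ncard * Fintype.card H
      = ∑ h : H, ∑ T ∈ (orbit H w).toFinset, (if h • T ∈ S then 1 else 0) := by
        simp only [row, Finset.sum_const, Finset.card_univ, smul_eq_mul, mul_comm]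
    _ = {h : H | h • w ∈ S}.ncard * (orbit H w).ncard := by
        rw [Finset.sum_comm, Finset.sum_congr rfl column, Finset.sum_const, smul_eq_mul,
          ← Set.ncard_eq_toFinset_card', mul_comm]

/-- By invariance and symmetry, `R v (h • w)` is equivalent to `R w (h⁻¹ • v)`. -/
theorem ncard_orbit_rel_div_comm (R : α → α → Prop) (hsymm : ∀ a b, R a b ↔ R b a)
    (hinv : ∀ (h : H) a b, R (h • a) (h • b) ↔ R a b) (v w : α) :
    ({T ∈ orbit H w | R v T}.ncard : ℚ) / ((orbit H w).ncard : ℚ) =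
      ({T ∈ orbit H v | R w T}.ncard : ℚ) / ((orbit H v).ncard : ℚ) := by
  refine (ncard_orbit_inter_div w {T | R v T}).trans
    (Eq.trans ?_ (ncard_orbit_inter_div v {T | R w T}).symm)
  congr 2
  refine Set.ncard_congr (fun h _ => h⁻¹) ?_ (fun _ _ _ _ e => inv_injective e) ?_
  · intro h hh
    simp only [Set.mem_ofPred_eq] at hh ⊢
    rwa [← hinv h, smul_inv_smul, hsymm]
  · intro h hh
    simp only [Set.mem_ofPred_eq] at hh
    refine ⟨h⁻¹, ?_, inv_inv h⟩
    simp only [Set.mem_ofPred_eq]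
    rwa [← hinv h, smul_inv_smul, hsymm]

end MulAction

/-! ### Single-qubit multiplication and signs -/

namespace Pauli

/-- The product of two Pauli operators up to phase. -/
def mul : Pauli → Pauli → Pauli
  | I, q => q
  | p, I => p
  | X, X => I
  | X, Y => Z
  | X, Z => Y
  | Y, X => Z
  | Y, Y => I
  | Y, Z => X
  | Z, X => Y
  | Z, Y => X
  | Z, Z => I

/-- The commutation sign of two Pauli operators. -/
def sign (p q : Pauli) : ℤ := if p = I ∨ q = I ∨ p = q then 1 else -1

theorem toMatrix_mul (p q : Pauli) :
    ∃ c : ℂ, c ≠ 0 ∧ p.toMatrix * q.toMatrix = c • (mul p q).toMatrix := by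
  have key : ∃ c ∈ ({1, Complex.I, -Complex.I} : Set ℂ),
      p.toMatrix * q.toMatrix = c • (mul p q).toMatrix := by
    simp only [Set.mem_insert_iff, Set.mem_singleton_iff, exists_eq_or_imp, exists_eq_left]
    cases p <;> cases q <;>
    first
    | (left; ext i j; fin_cases i <;> fin_cases j <;>
        simp [toMatrix, mul, Matrix.mul_apply, Fin.sum_univ_two]; done)
    | (right; left; ext i j; fin_cases i <;> fin_cases j <;>
        simp [toMatrix, mul, Matrix.mul_apply, Fin.sum_univ_two]; done)
    | (right; right; ext i j; fin_cases i <;> fin_cases j <;>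
        simp [toMatrix, mul, Matrix.mul_apply, Fin.sum_univ_two])
  obtain ⟨c, hc, h⟩ := key
  refine ⟨c, ?_, h⟩
  rcases hc with rfl | rfl | rfl <;> simp

theorem toMatrix_mul_comm (p q : Pauli) :
    p.toMatrix * q.toMatrix = (sign p q : ℂ) • (q.toMatrix * p.toMatrix) := by
  cases p <;> cases q <;> ext i j <;> fin_cases i <;> fin_cases j <;>
    simp [toMatrix, sign, Matrix.mul_apply, Fin.sum_univ_two]

theorem sign_comm (p q : Pauli) : sign p q = sign q p := by
  cases p <;> cases q <;> rfl

theorem sign_self (p : Pauli) : sign p p = 1 := by cases p <;> rfl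

theorem sign_I_right (p : Pauli) : sign p I = 1 := by cases p <;> rfl

theorem sign_eq (p q : Pauli) : sign p q = 1 ∨ sign p q = -1 := by
  unfold sign; split_ifs <;> simp

theorem sign_mul (p q r : Pauli) : sign (mul p q) r = sign p r * sign q r := by
  cases p <;> cases q <;> cases r <;> rfl

theorem mul_mul_cancel_right (p q : Pauli) : mul (mul p q) q = p := by
  cases p <;> cases q <;> rfl

theorem eq_of_sign_eq {p q : Pauli} (h : ∀ r, sign p r = sign q r) : p = q := by
  revert p q; decide

end Pauli

/-! ### Pauli strings modulo phase and their transvections -/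

namespace PauliString

variable {n : ℕ}

/-- The product of two Pauli strings up to phase. -/
def mul (P Q : PauliString n) : PauliString n := fun i => (P i).mul (Q i)

/-- The commutation sign of two Pauli strings. -/
def sign (P Q : PauliString n) : ℤ := ∏ i, (P i).sign (Q i)

theorem toMatrix_mul (P Q : PauliString n) :
    ∃ c : ℂ, c ≠ 0 ∧ P.toMatrix * Q.toMatrix = c • (mul P Q).toMatrix := by
  choose c hc h using fun i => Pauli.toMatrix_mul (P i) (Q i)
  refine ⟨∏ i, c i, Finset.prod_ne_zero_iff.mpr fun i _ => hc i, ?_⟩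
  ext a b
  rw [Matrix.smul_apply, toMatrix_mul_apply, smul_eq_mul, toMatrix, Matrix.of_apply,
    ← Finset.prod_mul_distrib]
  exact Finset.prod_congr rfl fun i _ => by rw [h i]; rfl

theorem toMatrix_mul_comm (P Q : PauliString n) :
    P.toMatrix * Q.toMatrix = (sign P Q : ℂ) • (Q.toMatrix * P.toMatrix) := by
  ext a b
  rw [Matrix.smul_apply, toMatrix_mul_apply, toMatrix_mul_apply, smul_eq_mul, sign,
    Int.cast_prod, ← Finset.prod_mul_distrib]
  exact Finset.prod_congr rfl fun i _ => by rw [Pauli.toMatrix_mul_comm]; rfl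

theorem sign_comm (P Q : PauliString n) : sign P Q = sign Q P :=
  Finset.prod_congr rfl fun _ _ => Pauli.sign_comm _ _

theorem sign_self (P : PauliString n) : sign P P = 1 :=
  Finset.prod_eq_one fun _ _ => Pauli.sign_self _

theorem sign_eq (P Q : PauliString n) : sign P Q = 1 ∨ sign P Q = -1 := by
  refine Finset.prod_induction _ (fun x : ℤ => x = 1 ∨ x = -1) ?_ (Or.inl rfl)
    fun i _ => Pauli.sign_eq _ _
  rintro x y (rfl | rfl) (rfl | rfl) <;> simp

theorem sign_mul_left (P Q R : PauliString n) : sign (mul P Q) R = sign P R * sign Q R := by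
  simp only [sign, mul, Pauli.sign_mul, Finset.prod_mul_distrib]

theorem sign_mul_right (P Q R : PauliString n) : sign R (mul P Q) = sign R P * sign R Q := by
  rw [sign_comm, sign_mul_left, sign_comm P, sign_comm Q]

theorem mul_mul_cancel_right (P Q : PauliString n) : mul (mul P Q) Q = P :=
  funext fun _ => Pauli.mul_mul_cancel_right _ _

/-- Nondegeneracy of the sign pairing: strings supported on one qubit detect each factor. -/
theorem eq_of_sign_eq {P Q : PauliString n} (h : ∀ R, sign P R = sign Q R) : P = Q := by
  have single (S : PauliString n) (i : Fin n) (r : Pauli) :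
      sign S (Function.update (fun _ => Pauli.I) i r) = (S i).sign r := by
    rw [sign, Finset.prod_eq_single i]
    · simp
    · intro j _ hj
      simp [hj, Pauli.sign_I_right]
    · simp
  funext i
  refine Pauli.eq_of_sign_eq fun r => ?_
  rw [← single, ← single, h]

theorem toMatrix_ne_zero (P : PauliString n) : P.toMatrix ≠ 0 := by
  intro h
  have := P.toMatrix_mul_self
  rw [h, mul_zero] at this
  exact zero_ne_one this

theorem toMatrix_mul_ne_zero (P Q : PauliString n) : P.toMatrix * Q.toMatrix ≠ 0 := by
  obtain ⟨c, hc, h⟩ := toMatrix_mul P Q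
  rw [h]
  exact smul_ne_zero hc (toMatrix_ne_zero _)

/-- Rescaling a matrix does not change its commutation signs, and these determine the string. -/
theorem eq_of_toMatrix_eq_smul {P Q : PauliString n} {c : ℂ}
    (h : P.toMatrix = c • Q.toMatrix) : P = Q := by
  refine eq_of_sign_eq fun R => ?_
  have e := toMatrix_mul_comm P R
  have hc : c ≠ 0 := by
    rintro rfl
    exact toMatrix_ne_zero P (by rw [h, zero_smul])
  have hne := smul_ne_zero hc (toMatrix_mul_ne_zero R Q)
  rw [h, smul_mul_assoc, mul_smul_comm, toMatrix_mul_comm Q R, smul_comm] at e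
  exact_mod_cast (smul_left_injective ℂ hne e).symm

theorem commutes_iff (P Q : PauliString n) : P.Commutes Q ↔ sign P Q = 1 := by
  rw [Commutes, toMatrix_mul_comm P Q]
  rcases sign_eq P Q with h | h
  · simp [h]
  · rw [h]
    have : ((-1 : ℤ) : ℂ) • (Q.toMatrix * P.toMatrix) - Q.toMatrix * P.toMatrix =
        (-2 : ℂ) • (Q.toMatrix * P.toMatrix) := by
      push_cast; module
    rw [this]
    simp [toMatrix_mul_ne_zero]

theorem anticommutes_iff (P Q : PauliString n) : P.Anticommutes Q ↔ sign P Q = -1 := by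
  rw [Anticommutes, toMatrix_mul_comm P Q]
  rcases sign_eq P Q with h | h
  · rw [h]
    have : ((1 : ℤ) : ℂ) • (Q.toMatrix * P.toMatrix) + Q.toMatrix * P.toMatrix =
        (2 : ℂ) • (Q.toMatrix * P.toMatrix) := by
      push_cast; module
    rw [this]
    simp [toMatrix_mul_ne_zero]
  · simp [h]

/-- The symplectic transvection along `X`, multiplying by `X` the strings that anticommute
with `X` and fixing the others. -/
def transvection (X P : PauliString n) : PauliString n := if sign P X = 1 then P else mul P X

theorem transvection_involutive (X : PauliString n) :
    Function.Involutive (transvection X) := by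
  intro P
  by_cases h : sign P X = 1
  · simp [transvection, h]
  · simp [transvection, h, sign_mul_left, sign_self, mul_mul_cancel_right]

/-- The sign is bimultiplicative. If both strings move, the two extra factors `-1` cancel; if only
one moves, the extra factor is the sign of the fixed string with `X`, which is `1`. -/
theorem sign_transvection (X P Q : PauliString n) :
    sign (transvection X P) (transvection X Q) = sign P Q := by
  unfold transvection
  rcases sign_eq P X with h | h <;> rcases sign_eq Q X with h' | h' <;>
    simp [h, h', sign_mul_left, sign_mul_right, sign_self, sign_comm X]

/-- The group generated by the transvections along the elements of `G`. -/
def transvectionGroup (G : Set (PauliString n)) : Subgroup (Equiv.Perm (PauliString n)) :=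
  Subgroup.closure ((fun X => (transvection_involutive X).toPerm) '' G)

theorem sign_smul (G : Set (PauliString n)) (h : transvectionGroup G) (P Q : PauliString n) :
    sign (h • P) (h • Q) = sign P Q := by
  obtain ⟨h, hh⟩ := h
  change sign (h P) (h Q) = sign P Q
  induction hh using Subgroup.closure_induction generalizing P Q with
  | mem x hx =>
    obtain ⟨X, -, rfl⟩ := hx
    exact sign_transvection X P Q
  | one => rfl
  | mul x y _ _ hx hy => exact (hx _ _).trans (hy _ _)
  | inv x _ hx => simpa using (hx (x⁻¹ P) (x⁻¹ Q)).symm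

end PauliString

/-! ### Components as orbits -/

open PauliString in
theorem commutatorGraph_adj_iff {n : ℕ} (G : Set (PauliString n)) (P Q : PauliString n) :
    (commutatorGraph G).Adj P Q ↔ ∃ X ∈ G, sign P X = -1 ∧ Q = mul P X := by
  change (∃ X ∈ G, ∃ c : ℂ, c ≠ 0 ∧ _) ↔ _
  refine exists_congr fun X => and_congr_right fun _ => ?_
  obtain ⟨d, hd, hmul⟩ := toMatrix_mul P X
  have bracket (h : sign P X = -1) :
      P.toMatrix * X.toMatrix - X.toMatrix * P.toMatrix = (2 * d) • (mul P X).toMatrix := by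
    rw [toMatrix_mul_comm X P, sign_comm, h, hmul]
    push_cast; module
  constructor
  · rintro ⟨c, hc, h⟩
    have hs : sign P X = -1 := (sign_eq P X).resolve_left fun h1 =>
      smul_ne_zero hc (toMatrix_ne_zero Q) (h.symm.trans ((commutes_iff P X).mpr h1))
    refine ⟨hs, eq_of_toMatrix_eq_smul (c := c⁻¹ * (2 * d)) ?_⟩
    rw [mul_smul, ← bracket hs, h, smul_smul, inv_mul_cancel₀ hc, one_smul]
  · rintro ⟨hs, rfl⟩
    exact ⟨2 * d, mul_ne_zero two_ne_zero hd, bracket hs⟩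

open PauliString in
theorem component_eq_orbit {n : ℕ} (G : Set (PauliString n)) (P : PauliString n) :
    component G P = MulAction.orbit (transvectionGroup G) P := by
  ext Q
  rw [component, SimpleGraph.ConnectedComponent.mem_supp_iff, SimpleGraph.ConnectedComponent.eq]
  constructor
  · intro h
    -- The path is reversed so that the induction grows it from the base point `P`.
    rw [SimpleGraph.reachable_comm, SimpleGraph.reachable_iff_reflTransGen] at h
    induction h with
    | refl => exact MulAction.mem_orbit_self P
    | tail _ hadj ih =>
      obtain ⟨X, hX, hs, rfl⟩ := (commutatorGraph_adj_iff G _ _).mp hadj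
      have := MulAction.mem_orbit_of_mem_orbit
        (⟨_, Subgroup.subset_closure ⟨X, hX, rfl⟩⟩ : transvectionGroup G) ih
      simpa [Subgroup.smul_def, transvection, hs] using this
  · rintro ⟨⟨h, hh⟩, rfl⟩
    change (commutatorGraph G).Reachable (h P) P
    induction hh using Subgroup.closure_induction generalizing P with
    | mem x hx =>
      obtain ⟨X, hX, rfl⟩ := hx
      change (commutatorGraph G).Reachable (transvection X P) P
      rcases sign_eq P X with hs | hs
      · simp [transvection, hs]
      · refine (SimpleGraph.Adj.reachable ?_).symm
        exact (commutatorGraph_adj_iff G _ _).mpr ⟨X, hX, hs, by simp [transvection, hs]⟩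
    | one => exact SimpleGraph.Reachable.refl _
    | mul x y _ _ hx hy => exact (hx _).trans (hy _)
    | inv x _ hx => simpa using (hx (x⁻¹ P)).symm

theorem corollary2 (n : ℕ) (G : Set (PauliString n)) (V W : PauliString n) :
    (({T ∈ component G W | V.Commutes T}.ncard : ℚ) / ((component G W).ncard : ℚ) =
      ({T ∈ component G V | W.Commutes T}.ncard : ℚ) / ((component G V).ncard : ℚ)) ∧
    (({T ∈ component G W | V.Anticommutes T}.ncard : ℚ) / ((component G W).ncard : ℚ) =
      ({T ∈ component G V | W.Anticommutes T}.ncard : ℚ) / ((component G V).ncard : ℚ)) := by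
  have := Fintype.ofFinite (PauliString.transvectionGroup G)
  simp only [component_eq_orbit]
  constructor
  · refine MulAction.ncard_orbit_rel_div_comm _ (fun P Q => ?_) (fun h P Q => ?_) V W
    · simp only [PauliString.commutes_iff, PauliString.sign_comm]
    · simp only [PauliString.commutes_iff, PauliString.sign_smul]
  · refine MulAction.ncard_orbit_rel_div_comm _ (fun P Q => ?_) (fun h P Q => ?_) V W
    · simp only [PauliString.anticommutes_iff, PauliString.sign_comm]
    · simp only [PauliString.anticommutes_iff, PauliString.sign_smul]
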